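/- All groups are finite. For a group $G$ and a subgroup $N$, $(G,N)$ is a Camina pair if $N$ is a proper nontrivial normal subgroup of $G$ and every $x\in G\setminus N$ is conjugate in $G$ to every element of the coset $xN$. A Camina pair $(G,N)$ is of Type (4) if there is a prime $q$ such that $G/N$ is a $q$-group and $q$ divides $|N|$, but $N$ is not a $q$-group. A triple $(G,H,L)$ is a Frobenius–Wielandt triple if $H$ is a proper nontrivial subgroup of $G$, $L$ is a proper normal subgroup of $H$, and $H\cap H^g\le L$ for all $g\in G\setminus H$. A normal $p$-complement of $G$ is a normal subgroup of $G$ whose order is prime to $p$ and whose index is a power of $p$. **Theorem.** Let $p$ be a prime, let $G$ be a group with a normal subgroup $N$, and let $P$ be a Sylow $p$-subgroup of $G$. Then $(G,N)$ is a Camina pair of Type (4) where $G/N$ is a $p$-group if and only if the following three conditions all hold: 1. $(G,P,P\cap N)$ is a Frobenius–Wielandt triple; 2. $(P,P\cap N)$ is a Camina pair; 3. $G$ has a normal $p$-complement that is properly contained in $N$. -/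

import Mathlib

/-- `(G, N)` is a Camina pair: `N` is a proper nontrivial normal subgroup of `G` and every
`x ∈ G \ N` is conjugate in `G` to every element of the coset `xN`. -/
structure IsCaminaPair {G : Type*} [Group G] (N : Subgroup G) : Prop where
  normal : N.Normal
  ne_bot : N ≠ ⊥
  ne_top : N ≠ ⊤
  isConj : ∀ x : G, x ∉ N → ∀ n ∈ N, IsConj x (x * n)

/-- `(G, N)` is a Camina pair of Type (4): for some prime `p`, `G ⧸ N` is a `p`-group and `p`
divides `|N|`, but `N` is not a `p`-group. -/
def IsCaminaPairType4 {G : Type*} [Group G] (N : Subgroup G) [N.Normal] : Prop :=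
  IsCaminaPair N ∧
    ∃ p : ℕ, p.Prime ∧ IsPGroup p (G ⧸ N) ∧ p ∣ Nat.card N ∧ ¬ IsPGroup p N

/-- `(G, H, L)` is a Frobenius–Wielandt triple: `H` is a proper nontrivial subgroup of `G`,
`L` is a proper normal subgroup of `H`, and `H ∩ gHg⁻¹ ≤ L` for all `g ∈ G \ H`. -/
structure IsFrobeniusWielandtTriple {G : Type*} [Group G] (H L : Subgroup G) : Prop where
  ne_bot : H ≠ ⊥
  ne_top : H ≠ ⊤
  lt : L < H
  normal : (L.subgroupOf H).Normal
  inf_conj_le : ∀ g : G, g ∉ H → H ⊓ H.map (MulAut.conj g).toMonoidHom ≤ L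

/-- `K` is a normal `p`-complement of `G`: a normal subgroup of order prime to `p` whose index
is a power of `p`. -/
structure IsNormalPComplement (p : ℕ) {G : Type*} [Group G] (K : Subgroup G) : Prop where
  normal : K.Normal
  not_dvd_card : ¬ p ∣ Nat.card K
  index_eq : ∃ n : ℕ, K.index = p ^ n

/-! Write `Q = G/N`. For surjective `f`, always `|C(f x)| ≤ |C(x)|`, with equality exactly when `x`
is conjugate to all of `x * ker f`. If `(G, N)` is a Camina pair with `Q` a `p`-group, then `P` maps
onto `Q`, so for `x ∈ P \ N` `|C_Q(xN)| ≤ |C_P(x)| ≤ |C_G(x)| = |C_Q(xN)|`. Equality gives the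
Camina property of `(P, P ∩ N)` and `C_G(x) ≤ P`; together these give the Frobenius–Wielandt
condition. The Camina property also forces `P ∩ N ≤ P'`, and a transfer argument (a case of Tate's
theorem) then yields the normal `p`-complement inside `N`. Conversely, let `K` be the complement.
The triple makes `C_K(y)` trivial for `y ∈ P \ N`, so `y` is conjugate to all of `Ky`. As `G = KP`,
conjugacy in `G` reduces to conjugacy in `P`. -/

open Subgroup

/-! ### Normal `p`-complements by transfer -/

section NormalComplement

open scoped IsMulCommutative

variable {p : ℕ} {G : Type*} [Group G]

/-- The fibre product of `G` and `Q` over `G ⧸ M`. -/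
def fibreProduct (M : Subgroup G) [M.Normal] {Q : Type*} [Group Q] (π : Q →* G ⧸ M) :
    Subgroup (G × Q) :=
  ((QuotientGroup.mk' M).comp (MonoidHom.fst G Q)).eqLocus (π.comp (MonoidHom.snd G Q))

theorem mem_fibreProduct {M : Subgroup G} [M.Normal] {Q : Type*} [Group Q] {π : Q →* G ⧸ M}
    {e : G × Q} : e ∈ fibreProduct M π ↔ (e.1 : G ⧸ M) = π e.2 := Iff.rfl

/-- A transfer homomorphism from the pullback to `G` of a central extension of `G ⧸ M` which splits
over a Sylow subgroup. -/
theorem exists_hom_fibreProduct [Finite G] (P : Sylow p G) (M : Subgroup G) [M.Normal]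
    {Q : Type*} [Group Q] [Finite Q] (π : Q →* G ⧸ M) (hπ : Function.Surjective π)
    (hc : π.ker ≤ center Q)
    (j : P →* Q) (hj : ∀ x : P, π (j x) = (x : G)) :
    ∃ V : fibreProduct M π →* center Q, ∀ (z : Q) (hz : ((1 : G), z) ∈ fibreProduct M π),
      (V ⟨(1, z), hz⟩ : Q) = z ^ (P : Subgroup G).index := by
  let f : fibreProduct M π →* G := (MonoidHom.fst G Q).comp (fibreProduct M π).subtype
  have hf : Function.Surjective f := fun g => by
    obtain ⟨u, hu⟩ := hπ (g : G ⧸ M)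
    exact ⟨⟨(g, u), mem_fibreProduct.mpr hu.symm⟩, rfl⟩
  let H : Subgroup (fibreProduct M π) := (P : Subgroup G).comap f
  have hH : H.index = (P : Subgroup G).index := index_comap_of_surjective _ hf
  -- Over `P` the extension is split by `j`; the deviation `(j g)⁻¹ * u` of `(g, u)` from the
  -- splitting is central, hence multiplicative. Its transfer to the whole fibre product is `V`.
  have hmem : ∀ e : H, (j ⟨f e, e.2⟩)⁻¹ * (e : fibreProduct M π).1.2 ∈ π.ker := fun e => by
    have h := mem_fibreProduct.mp e.1.2
    rw [MonoidHom.mem_ker, map_mul, map_inv, hj, ← h]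
    exact inv_mul_cancel _
  let r : H →* center Q :=
    { toFun := fun e => ⟨(j ⟨f e, e.2⟩)⁻¹ * (e : fibreProduct M π).1.2, hc (hmem e)⟩
      map_one' := by
        apply Subtype.ext
        have : (⟨f (1 : H), (1 : H).2⟩ : P) = 1 := Subtype.ext rfl
        simp only [this]
        simp
      map_mul' := fun a b => by
        apply Subtype.ext
        have h1 : (⟨f (a * b : H), (a * b : H).2⟩ : P) = ⟨f a, a.2⟩ * ⟨f b, b.2⟩ := Subtype.ext rfl
        have h2 := mem_center_iff.mp (hc (hmem a)) (j ⟨f b, b.2⟩)⁻¹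
        simp only [h1, map_mul, mul_inv_rev]
        change _ * _ * (a.1.1.2 * b.1.1.2) = (_ * a.1.1.2) * (_ * b.1.1.2)
        simp only [mul_assoc] at h2 ⊢
        rw [← mul_assoc a.1.1.2 _ b.1.1.2, ← mul_assoc _ (a.1.1.2 * _) b.1.1.2, ← h2]
        simp only [mul_assoc] }
  refine ⟨MonoidHom.transfer r, fun z hz => ?_⟩
  have hzc : z ∈ center Q := hc (by
    have := mem_fibreProduct.mp hz
    exact this.symm.trans rfl)
  -- `(1, z)` is central, so its transfer is `r` of its power with exponent the index.
  have key : ∀ (k : ℕ) (e : fibreProduct M π),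
      e⁻¹ * (⟨(1, z), hz⟩ : fibreProduct M π) ^ k * e = (⟨(1, z), hz⟩ : fibreProduct M π) ^ k := by
    intro k e
    have hce : Commute (⟨(1, z), hz⟩ : fibreProduct M π) e := by
      apply Subtype.ext
      apply Prod.ext
      · change 1 * e.1.1 = e.1.1 * 1
        simp
      · exact (mem_center_iff.mp hzc _).symm
    rw [mul_assoc, (hce.pow_left k).eq, inv_mul_cancel_left]
  rw [MonoidHom.transfer_eq_pow r _ fun k e _ => key k e]
  have hr : ∀ (e : H), f e = 1 → (r e : Q) = (e : fibreProduct M π).1.2 := fun e he => by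
    change (j ⟨f e, e.2⟩)⁻¹ * (e : fibreProduct M π).1.2 = _
    rw [show (⟨f e, e.2⟩ : P) = 1 from Subtype.ext he, map_one, inv_one, one_mul]
  rw [hr _ (by
    change f ((⟨(1, z), hz⟩ : fibreProduct M π) ^ H.index) = 1
    rw [map_pow]
    exact one_pow _), ← hH]
  rfl

variable [Fact p.Prime] [Finite G]

theorem Sylow.sup_eq_top_of_index_eq_pow (P : Sylow p G) {M : Subgroup G} {n : ℕ}
    (hM : M.index = p ^ n) : (P : Subgroup G) ⊔ M = ⊤ := by
  rw [← index_eq_one]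
  have h1 : ((P : Subgroup G) ⊔ M).index ∣ (P : Subgroup G).index := index_dvd_of_le le_sup_left
  have h2 : ((P : Subgroup G) ⊔ M).index ∣ p ^ n := hM ▸ index_dvd_of_le le_sup_right
  have hc : ((P : Subgroup G).index).Coprime (p ^ n) :=
    (((Fact.out : p.Prime).coprime_iff_not_dvd.mpr P.not_dvd_index).pow_left n).symm
  exact Nat.eq_one_of_dvd_coprimes hc h1 h2

theorem Sylow.mk_surjective_of_index_eq_pow (P : Sylow p G) {M : Subgroup G} [M.Normal] {n : ℕ}
    (hM : M.index = p ^ n) :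
    Function.Surjective ((QuotientGroup.mk' M).comp (P : Subgroup G).subtype) := by
  intro q
  obtain ⟨g, rfl⟩ := QuotientGroup.mk'_surjective M q
  have hg : g ∈ (P : Subgroup G) ⊔ M := P.sup_eq_top_of_index_eq_pow hM ▸ mem_top g
  obtain ⟨x, hx, m, hm, rfl⟩ := mem_sup_of_normal_right.mp hg
  refine ⟨⟨x, hx⟩, ?_⟩
  simpa [QuotientGroup.eq] using hm

theorem Sylow.not_dvd_card_of_subgroupOf_eq_bot (P : Sylow p G) {M : Subgroup G} [M.Normal] {k : ℕ}
    (hk : M.index = p ^ k) (hbot : M.subgroupOf P = ⊥) : ¬ p ∣ Nat.card M := by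
  have hinj : Function.Injective ((QuotientGroup.mk' M).comp (P : Subgroup G).subtype) := by
    rw [← MonoidHom.ker_eq_bot_iff, ← hbot, ← MonoidHom.comap_ker, QuotientGroup.ker_mk']
    rfl
  have hcard : Nat.card P = M.index :=
    Nat.card_congr (Equiv.ofBijective _ ⟨hinj, P.mk_surjective_of_index_eq_pow hk⟩)
  have hMP : Nat.card M = (P : Subgroup G).index := by
    refine Nat.eq_of_mul_eq_mul_right (Nat.card_pos (α := P)) ?_
    rw [(P : Subgroup G).index_mul_card, hcard, M.card_mul_index]
  rw [hMP]
  exact P.not_dvd_index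

/-- If `M` is minimal among the normal subgroups of `p`-power index, homomorphisms from `M` to an
abelian `p`-group whose kernel is normal in `G` are trivial. -/
theorem hom_eq_one_of_minimal {M : Subgroup G}
    (hM : Minimal (fun M : Subgroup G => M.Normal ∧ ∃ n, M.index = p ^ n) M)
    {A : Type*} [Group A] (hA : IsPGroup p A) (φ : M →* A)
    (hφ : (φ.ker.map M.subtype).Normal) (m : M) : φ m = 1 := by
  obtain ⟨n, hn⟩ := hM.prop.2
  have hle : φ.ker.map M.subtype ≤ M := map_subtype_le _
  -- The kernel has `p`-power index in `M`, hence in `G`, so minimality makes it all of `M`.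
  have hP : IsPGroup p (M ⧸ φ.ker) := hA.of_injective _ (QuotientGroup.kerLift_injective φ)
  obtain ⟨k, hk⟩ := IsPGroup.iff_card.mp hP
  have hidx : (φ.ker.map M.subtype).index = p ^ (k + n) := by
    rw [index_map_subtype, hn, pow_add]
    exact congrArg (· * p ^ n) hk
  have := hM.le_of_le ⟨hφ, _, hidx⟩ hle m.2
  obtain ⟨m', hm', h⟩ := this
  rw [← Subtype.ext h]
  exact hm'

/-- A special case of Tate's theorem. -/
theorem inf_eq_bot_of_le_commutator (P : Sylow p G) {M : Subgroup G}
    (hM : Minimal (fun M : Subgroup G => M.Normal ∧ ∃ n, M.index = p ^ n) M)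
    (hS : M.subgroupOf P ≤ commutator P) : M.subgroupOf P = ⊥ := by
  have hMn : M.Normal := hM.prop.1
  obtain ⟨n, hn⟩ := hM.prop.2
  set S : Subgroup P := M.subgroupOf P with hSdef
  -- `P` is nilpotent, so `S ≤ [S, P]` pushes `S` down the lower central series to the trivial
  -- group.
  suffices hST : S ≤ ⁅S, ⊤⁆ by
    have hP : Group.IsNilpotent P := P.isPGroup'.isNilpotent
    obtain ⟨k, hk⟩ := Subgroup.nilpotent_iff_lowerCentralSeries.mp hP
    have hle : ∀ i, S ≤ (⊤ : Subgroup P).lowerCentralSeries i := by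
      intro i
      induction i with
      | zero => exact le_top
      | succ i ih =>
        rw [Subgroup.lowerCentralSeries_succ]
        exact hST.trans (commutator_mono ih le_rfl)
    exact le_bot_iff.mp (hk ▸ hle k)
  set T : Subgroup P := ⁅S, ⊤⁆ with hT
  have hTS : T ≤ S := commutator_le_left S ⊤
  let π : P ⧸ T →* G ⧸ M := QuotientGroup.lift T ((QuotientGroup.mk' M).comp (P : Subgroup G).subtype)
    (fun x hx => (QuotientGroup.eq_one_iff _).mpr (hTS hx))
  have hj : ∀ x : P, π (QuotientGroup.mk' T x) = (x : G) := fun x => rfl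
  have hπ : Function.Surjective π := fun q => by
    obtain ⟨x, hx⟩ := P.mk_surjective_of_index_eq_pow hn q
    exact ⟨QuotientGroup.mk' T x, hx⟩
  have hc : π.ker ≤ center (P ⧸ T) := by
    intro z hz
    obtain ⟨s, rfl⟩ := QuotientGroup.mk'_surjective T z
    have hs : s ∈ S := by
      have hz' : ((s : G) : G ⧸ M) = 1 := hz
      exact (QuotientGroup.eq_one_iff (N := M) (s : G)).mp hz'
    refine mem_center_iff.mpr fun w => ?_
    obtain ⟨w, rfl⟩ := QuotientGroup.mk'_surjective T w
    rw [← map_mul, ← map_mul]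
    refine (QuotientGroup.eq.mpr ?_)
    have : s⁻¹ * w⁻¹ * s⁻¹⁻¹ * w⁻¹⁻¹ ∈ T := commutator_mem_commutator (inv_mem hs) (mem_top _)
    simpa [mul_assoc] using this
  obtain ⟨V, hV⟩ := exists_hom_fibreProduct P M π hπ hc (QuotientGroup.mk' T) hj
  have hQ : IsPGroup p (P ⧸ T) := P.isPGroup'.to_quotient T
  let i : M →* fibreProduct M π :=
    { toFun := fun m => ⟨((m : G), 1), mem_fibreProduct.mpr
        ((QuotientGroup.eq_one_iff _).mpr m.2 |>.trans (map_one π).symm)⟩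
      map_one' := rfl
      map_mul' := fun a b => Subtype.ext (Prod.ext rfl (one_mul 1).symm) }
  -- Each `g` lifts to the fibre product and `V` has abelian values, so this kernel is normal in
  -- `G`.
  have hVi : ∀ m, (V.comp i) m = 1 := by
    refine hom_eq_one_of_minimal hM (hQ.to_subgroup _) (V.comp i) ⟨?_⟩
    rintro _ ⟨m, hm, rfl⟩ g
    obtain ⟨u, hu⟩ := hπ (g : G ⧸ M)
    refine ⟨⟨g * m * g⁻¹, hMn.conj_mem _ m.2 g⟩, ?_, rfl⟩
    let e : fibreProduct M π := ⟨(g, u), mem_fibreProduct.mpr hu.symm⟩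
    have he : i ⟨g * m * g⁻¹, hMn.conj_mem _ m.2 g⟩ = e * i m * e⁻¹ :=
      Subtype.ext (Prod.ext rfl (by
        change 1 = u * 1 * u⁻¹
        simp))
    have hm' : V (i m) = 1 := hm
    change V (i _) = 1
    rw [he, map_mul, map_mul, hm', mul_one, map_inv, mul_inv_cancel]
  let d : P →* fibreProduct M π :=
    { toFun := fun x => ⟨((x : G), QuotientGroup.mk' T x), mem_fibreProduct.mpr (hj x).symm⟩
      map_one' := rfl
      map_mul' := fun a b => rfl }
  intro s hs
  have hd : V (d s) = 1 := Abelianization.commutator_subset_ker (V.comp d) (hS hs)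
  have h1s : ((1 : G), QuotientGroup.mk' T s) ∈ fibreProduct M π :=
    mem_fibreProduct.mpr (((QuotientGroup.eq_one_iff (N := M) (s : G)).mpr hs).symm)
  -- `V` kills `d s` because `s ∈ P'`, and kills the factor from `M`; what remains is `(sT) ^ |G :
  -- P| = 1` in a `p`-group, with exponent prime to `p`.
  have hsplit : d s = i ⟨s, hs⟩ * ⟨(1, QuotientGroup.mk' T s), h1s⟩ :=
    Subtype.ext (Prod.ext (mul_one _).symm (one_mul _).symm)
  have hpow : (QuotientGroup.mk' T s) ^ (P : Subgroup G).index = 1 := by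
    rw [← hV _ h1s]
    rw [hsplit, map_mul, show V (i ⟨s, hs⟩) = 1 from hVi _, one_mul] at hd
    rw [hd]
    rfl
  have hcop : p.Coprime (P : Subgroup G).index :=
    (Fact.out : p.Prime).coprime_iff_not_dvd.mpr P.not_dvd_index
  have := (hQ.powEquiv hcop).injective (a₁ := QuotientGroup.mk' T s) (a₂ := 1)
    (by simpa using hpow)
  exact (QuotientGroup.eq_one_iff _).mp this

/-- If `N` has `p`-power index and meets a Sylow `p`-subgroup `P` inside the commutator subgroup
of `P`, then `N` contains a normal `p`-complement. -/
theorem exists_isNormalPComplement_le (P : Sylow p G) {N : Subgroup G} [N.Normal] {n : ℕ}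
    (hN : N.index = p ^ n) (hS : N.subgroupOf P ≤ commutator P) :
    ∃ K : Subgroup G, IsNormalPComplement p K ∧ K ≤ N := by
  obtain ⟨M, hMN, hM⟩ := exists_minimal_le_of_wellFoundedLT
    (fun M : Subgroup G => M.Normal ∧ ∃ n, M.index = p ^ n) N ⟨inferInstance, n, hN⟩
  have hbot := inf_eq_bot_of_le_commutator P hM ((comap_mono hMN).trans hS)
  have hMn := hM.prop.1
  refine ⟨M, ⟨hM.prop.1, ?_, hM.prop.2⟩, hMN⟩
  obtain ⟨k, hk⟩ := hM.prop.2
  exact P.not_dvd_card_of_subgroupOf_eq_bot hk hbot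

end NormalComplement

/-! ### Centralizer orders in quotients -/

section Centralizer

variable {G Q : Type*} [Group G] [Group Q]

theorem Subgroup.centralizer_singleton_le_comap (f : G →* Q) (x : G) :
    centralizer {x} ≤ (centralizer {f x}).comap f := fun g hg => by
  rw [mem_centralizer_singleton_iff] at hg
  rw [mem_comap, mem_centralizer_singleton_iff, ← map_mul, hg, map_mul]

/-- Comparison of the centralizers of `x` and of its image modulo `f.ker`. -/
theorem exists_injective_quotient_centralizer (f : G →* Q) (x : G) :
    ∃ ψ : (↥((centralizer {f x}).comap f) ⧸ (centralizer {x}).subgroupOf ((centralizer {f x}).comap f))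
        → f.ker, Function.Injective ψ ∧
      (Function.Surjective ψ ↔ ∀ k ∈ f.ker, IsConj x (x * k)) := by
  set C := (centralizer {f x}).comap f with hC
  -- The map is `g ↦ x⁻¹ * (g x g⁻¹)`; its fibres are the cosets of the centralizer of `x`.
  have hψ : ∀ g : C, x⁻¹ * (g * x * (g : G)⁻¹) ∈ f.ker := fun g => by
    have hg := mem_centralizer_singleton_iff.mp (mem_comap.mp g.2)
    rw [MonoidHom.mem_ker, map_mul, map_mul, map_mul, hg, map_inv, map_inv]
    simp
  have key : ∀ g h : C, x⁻¹ * (g * x * (g : G)⁻¹) = x⁻¹ * (h * x * (h : G)⁻¹) ↔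
      (QuotientGroup.mk g : C ⧸ (centralizer {x}).subgroupOf C) = QuotientGroup.mk h := by
    intro g h
    rw [QuotientGroup.eq, mem_subgroupOf, mem_centralizer_singleton_iff, mul_right_inj]
    change _ ↔ (g : G)⁻¹ * h * x = x * ((g : G)⁻¹ * h)
    constructor
    · intro e
      calc (g : G)⁻¹ * h * x = (g : G)⁻¹ * (h * x * (h : G)⁻¹) * h := by group
        _ = x * ((g : G)⁻¹ * h) := by
          rw [← e]
          group
    · intro e
      calc (g : G) * x * (g : G)⁻¹ = g * (x * ((g : G)⁻¹ * h)) * (h : G)⁻¹ := by group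
        _ = h * x * (h : G)⁻¹ := by
          rw [← e]
          group
  refine ⟨fun q => ⟨_, hψ q.out⟩, fun a b hab => ?_, fun h k hk => ?_, fun h k => ?_⟩
  · have := (key _ _).mp (Subtype.ext_iff.mp hab)
    simpa using this
  · obtain ⟨q, hq⟩ := h ⟨k, hk⟩
    refine isConj_iff.mpr ⟨(q.out : C), ?_⟩
    have hq' := Subtype.ext_iff.mp hq
    exact inv_mul_eq_iff_eq_mul.mp hq'
  · obtain ⟨g, hg⟩ := isConj_iff.mp (h k k.2)
    have hgC : g ∈ C := by
      have h1 := congrArg f hg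
      rw [map_mul, map_mul, map_mul, map_inv, MonoidHom.mem_ker.mp k.2, mul_one,
        mul_inv_eq_iff_eq_mul] at h1
      exact mem_comap.mpr (mem_centralizer_singleton_iff.mpr h1)
    refine ⟨QuotientGroup.mk ⟨g, hgC⟩, Subtype.ext ?_⟩
    refine ((key _ ⟨g, hgC⟩).mpr (Quotient.out_eq' _)).trans ?_
    exact inv_mul_eq_iff_eq_mul.mpr hg

variable [Finite G]

theorem card_comap_centralizer (f : G →* Q) (hf : Function.Surjective f) (x : G) :
    Nat.card ((centralizer {f x}).comap f) = Nat.card f.ker * Nat.card (centralizer {f x}) := by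
  have : Finite Q := Finite.of_surjective f hf
  refine Nat.eq_of_mul_eq_mul_right (Nat.pos_of_ne_zero (centralizer {f x}).index_ne_zero_of_finite) ?_
  rw [mul_assoc, card_mul_index, ← index_comap_of_surjective _ hf, card_mul_index,
    ← f.ker.card_mul_index, index_ker, MonoidHom.range_eq_top.mpr hf, card_top]

theorem card_centralizer_map_le (f : G →* Q) (hf : Function.Surjective f) (x : G) :
    Nat.card (centralizer {f x}) ≤ Nat.card (centralizer {x}) := by
  obtain ⟨ψ, hinj, -⟩ := exists_injective_quotient_centralizer f x
  have h1 := Nat.card_le_card_of_injective ψ hinj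
  have h2 := card_mul_index ((centralizer {x}).subgroupOf ((centralizer {f x}).comap f))
  rw [card_comap_centralizer f hf,
    Nat.card_congr (subgroupOfEquivOfLe (centralizer_singleton_le_comap f x)).toEquiv] at h2
  refine Nat.le_of_mul_le_mul_left ?_ (Nat.card_pos (α := f.ker))
  rw [← h2, mul_comm]
  exact Nat.mul_le_mul_right _ h1

theorem card_centralizer_eq_iff (f : G →* Q) (hf : Function.Surjective f) (x : G) :
    Nat.card (centralizer {x}) = Nat.card (centralizer {f x}) ↔
      ∀ k ∈ f.ker, IsConj x (x * k) := by
  obtain ⟨ψ, hinj, hsurj⟩ := exists_injective_quotient_centralizer f x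
  have h2 := card_mul_index ((centralizer {x}).subgroupOf ((centralizer {f x}).comap f))
  rw [card_comap_centralizer f hf,
    Nat.card_congr (subgroupOfEquivOfLe (centralizer_singleton_le_comap f x)).toEquiv] at h2
  rw [← hsurj]
  constructor
  · intro h
    rw [← h, mul_comm] at h2
    exact ((Nat.bijective_iff_injective_and_card ψ).mpr
      ⟨hinj, Nat.eq_of_mul_eq_mul_right Nat.card_pos h2⟩).2
  · intro h
    have h1 : _ = Nat.card f.ker := Nat.card_congr (Equiv.ofBijective ψ ⟨hinj, h⟩)
    rw [mul_comm, index, h1] at h2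
    exact Nat.eq_of_mul_eq_mul_left Nat.card_pos h2

end Centralizer

/-! ### Camina pairs and Sylow subgroups -/

section Camina

variable {p : ℕ} {G : Type*} [Group G]

/-- For `x ∉ N`, conjugacy of `x⁻¹` to `x⁻¹ * k` exhibits `k` as a commutator. -/
theorem IsCaminaPair.le_commutator {N : Subgroup G} (hN : IsCaminaPair N) : N ≤ commutator G := by
  obtain ⟨x, hx⟩ : ∃ x, x ∉ N := by
    by_contra! h
    exact hN.ne_top ((eq_top_iff' N).mpr h)
  intro k hk
  obtain ⟨g, hg⟩ := isConj_iff.mp (hN.isConj x⁻¹ (by simpa using hx) k hk)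
  have hk' : k = x * g * x⁻¹ * g⁻¹ := by
    rw [← mul_right_inj x⁻¹, ← hg]
    group
  rw [hk']
  exact commutator_mem_commutator (mem_top x) (mem_top g)

variable [Fact p.Prime] [Finite G]

theorem isPGroup_quotient_iff_index {N : Subgroup G} [N.Normal] :
    IsPGroup p (G ⧸ N) ↔ ∃ n, N.index = p ^ n :=
  IsPGroup.iff_card

/-- Modulo a normal subgroup `N` of `p`-power index with `(G, N)` a Camina pair, an element `x ∉ N`
of a Sylow `p`-subgroup `P` has the same centralizer in `P` and in `G`, and is conjugate in `P` to
all elements of `x(P ∩ N)`. -/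
theorem IsCaminaPair.centralizer_le_sylow_and_isConj {N : Subgroup G} [N.Normal]
    (hN : IsCaminaPair N) {n : ℕ} (hn : N.index = p ^ n) (P : Sylow p G) {x : P} (hx : (x : G) ∉ N) :
    centralizer {(x : G)} ≤ P ∧ ∀ k ∈ N.subgroupOf P, IsConj x (x * k) := by
  let f : P →* G ⧸ N := (QuotientGroup.mk' N).comp (P : Subgroup G).subtype
  have hf : Function.Surjective f := P.mk_surjective_of_index_eq_pow hn
  have hker : f.ker = N.subgroupOf P := by
    rw [← MonoidHom.comap_ker, QuotientGroup.ker_mk']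
    rfl
  have hG := (card_centralizer_eq_iff (QuotientGroup.mk' N) (QuotientGroup.mk'_surjective N)
    (x : G)).mpr fun k hk => hN.isConj x hx k (by rwa [QuotientGroup.ker_mk'] at hk)
  have hle := card_centralizer_map_le f hf x
  have hmap : (centralizer {x}).map (P : Subgroup G).subtype ≤ centralizer {(x : G)} := by
    rintro _ ⟨g, hg, rfl⟩
    exact mem_centralizer_singleton_iff.mpr
      (congrArg Subtype.val (mem_centralizer_singleton_iff.mp hg))
  have hcm : Nat.card ((centralizer {x}).map (P : Subgroup G).subtype) =
      Nat.card (centralizer {x}) :=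
    card_map_of_injective (P : Subgroup G).subtype_injective
  have hge : Nat.card (centralizer {x}) ≤ Nat.card (centralizer {(x : G)}) :=
    hcm ▸ card_le_of_le hmap
  have hfx : f x = QuotientGroup.mk' N (x : G) := rfl
  rw [hfx, ← hG] at hle
  refine ⟨?_, ?_⟩
  · rw [← eq_of_le_of_card_ge hmap (hle.trans hcm.ge)]
    exact map_subtype_le _
  · rw [← hker]
    refine (card_centralizer_eq_iff f hf x).mp ?_
    rw [hfx, ← hG]
    exact le_antisymm hge hle

theorem IsCaminaPair.inf_map_conj_le {N : Subgroup G} [N.Normal]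
    (hN : IsCaminaPair N) {n : ℕ} (hn : N.index = p ^ n) (P : Sylow p G) {g : G}
    (hg : g ∉ (P : Subgroup G)) :
    (P : Subgroup G) ⊓ (P : Subgroup G).map (MulAut.conj g).toMonoidHom ≤ (P : Subgroup G) ⊓ N := by
  rintro y ⟨hy, x, hx, hxy⟩
  refine ⟨hy, ?_⟩
  by_contra hyN
  have hxy' : g * x * g⁻¹ = y := hxy
  have hxN : x ∉ N := fun h => hyN (hxy' ▸ Normal.conj_mem inferInstance x h g)
  obtain ⟨hC, hconj⟩ := hN.centralizer_le_sylow_and_isConj hn P (x := ⟨x, hx⟩) hxN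
  -- Replacing `g` by `u * g` with `u ∈ P` makes it trivial modulo `N`, so `u y u⁻¹` lies in `x(P ∩
  -- N)` and is conjugate to `x` by some `v ∈ P`. Then `v⁻¹ u g` centralizes `x`, so it lies in `P`,
  -- and so does `g`.
  obtain ⟨u, hu⟩ := P.mk_surjective_of_index_eq_pow hn ((g⁻¹ : G) : G ⧸ N)
  have hu' : ((u : G) : G ⧸ N) = (g⁻¹ : G) := hu
  have hk : x⁻¹ * (u * y * (u : G)⁻¹) ∈ N := by
    rw [← QuotientGroup.eq_one_iff, ← hxy']
    simp [hu', mul_assoc]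
  have hkP : x⁻¹ * (u * y * (u : G)⁻¹) ∈ (P : Subgroup G) :=
    mul_mem (inv_mem hx) (mul_mem (mul_mem u.2 hy) (inv_mem u.2))
  obtain ⟨v, hv⟩ := isConj_iff.mp (hconj ⟨_, hkP⟩ hk)
  have hv' : (v : G) * x * (v : G)⁻¹ = u * y * (u : G)⁻¹ := by
    have := congrArg Subtype.val hv
    simpa using this
  have hcent : (v : G)⁻¹ * u * g ∈ centralizer {x} := by
    rw [mem_centralizer_singleton_iff]
    rw [← hxy', mul_inv_eq_iff_eq_mul] at hv'
    calc (v : G)⁻¹ * u * g * x = (v : G)⁻¹ * (u * (g * x * g⁻¹) * (u : G)⁻¹ * v) * (v : G)⁻¹ * u * g := by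
          group
      _ = x * ((v : G)⁻¹ * u * g) := by
          rw [← hv']
          group
  refine hg ?_
  have : _ ∈ (P : Subgroup G) := mul_mem (inv_mem (mul_mem (inv_mem v.2) u.2)) (hC hcent)
  rwa [inv_mul_cancel_left] at this

/-- Any element centralizing `y` lies in `P`, since otherwise `y` would be in `P ∩ N`. As `P ∩ K` is
trivial, `c ↦ c y c⁻¹ y⁻¹` is injective on the finite set `K`, hence surjective. -/
theorem IsNormalPComplement.isConj_mul_left {N K : Subgroup G} (P : Sylow p G)
    (hFW : IsFrobeniusWielandtTriple (P : Subgroup G) ((P : Subgroup G) ⊓ N))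
    (hK : IsNormalPComplement p K) {y : G} (hy : y ∈ (P : Subgroup G)) (hyN : y ∉ N)
    {k : G} (hk : k ∈ K) : IsConj y (k * y) := by
  have hKn := hK.normal
  let φ : K → K := fun c => ⟨c * (y * (c : G)⁻¹ * y⁻¹),
    mul_mem c.2 (hKn.conj_mem _ (inv_mem c.2) y)⟩
  have hφ : Function.Injective φ := by
    intro a b hab
    have hab' : (a : G) * (y * (a : G)⁻¹ * y⁻¹) = b * (y * (b : G)⁻¹ * y⁻¹) :=
      congrArg Subtype.val hab
    have hcomm : (b : G)⁻¹ * a * y * ((b : G)⁻¹ * a)⁻¹ = y := by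
      calc (b : G)⁻¹ * a * y * ((b : G)⁻¹ * a)⁻¹
          = (b : G)⁻¹ * (a * (y * (a : G)⁻¹ * y⁻¹)) * y * b := by group
        _ = y := by
          rw [hab']
          group
    have hcP : (b : G)⁻¹ * a ∈ (P : Subgroup G) := by
      by_contra hc
      exact hyN (hFW.inf_conj_le _ hc ⟨hy, y, hy, hcomm⟩).2
    have hdisj : Disjoint (P : Subgroup G) K :=
      disjoint_of_coprime_natCard <| by
        obtain ⟨m, hm⟩ := IsPGroup.iff_card.mp P.isPGroup'
        rw [hm]
        exact ((Fact.out : p.Prime).coprime_iff_not_dvd.mpr hK.not_dvd_card).pow_left m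
    have h1 := disjoint_def.mp hdisj hcP (mul_mem (inv_mem b.2) a.2)
    exact Subtype.ext (inv_mul_eq_one.mp h1).symm
  obtain ⟨c, hc⟩ := Finite.surjective_of_injective hφ ⟨k, hk⟩
  have hc' : (c : G) * (y * (c : G)⁻¹ * y⁻¹) = k := congrArg Subtype.val hc
  refine isConj_iff.mpr ⟨c, ?_⟩
  rw [← hc']
  group

theorem IsCaminaPair.of_sylow {N K : Subgroup G} [N.Normal] (P : Sylow p G)
    (hFW : IsFrobeniusWielandtTriple (P : Subgroup G) ((P : Subgroup G) ⊓ N))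
    (hP : IsCaminaPair (((P : Subgroup G) ⊓ N).subgroupOf (P : Subgroup G)))
    (hK : IsNormalPComplement p K) (hKN : K < N) : IsCaminaPair N := by
  have hKn := hK.normal
  obtain ⟨m, hm⟩ := hK.index_eq
  refine ⟨inferInstance, (bot_le.trans_lt hKN).ne', ?_, fun x hx n hn => ?_⟩
  · rintro rfl
    exact hFW.lt.ne (inf_top_eq _)
  · have hdecomp : ∀ g : G, ∃ k ∈ K, ∃ y ∈ (P : Subgroup G), k * y = g := fun g =>
      mem_sup_of_normal_left.mp (sup_comm (P : Subgroup G) K ▸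
        P.sup_eq_top_of_index_eq_pow hm ▸ mem_top g)
    obtain ⟨k, hk, y, hy, hky⟩ := hdecomp x
    obtain ⟨k', hk', y', hy', hky'⟩ := hdecomp (x * n)
    have hmk : ∀ c ∈ N, (c : G ⧸ N) = 1 := fun c hc => (QuotientGroup.eq_one_iff c).mpr hc
    have hyx : (y : G ⧸ N) = x := by
      rw [← hky, QuotientGroup.mk_mul, hmk k (hKN.le hk), one_mul]
    have hyx' : (y' : G ⧸ N) = x := by
      have := congrArg (QuotientGroup.mk (s := N)) hky'
      rwa [QuotientGroup.mk_mul, QuotientGroup.mk_mul, hmk n hn, hmk k' (hKN.le hk'), one_mul,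
        mul_one] at this
    have hyN : y ∉ N := fun h => hx ((QuotientGroup.eq_one_iff x).mp (hyx ▸ hmk y h))
    have hyN' : y' ∉ N := fun h => hx ((QuotientGroup.eq_one_iff x).mp (hyx' ▸ hmk y' h))
    have hyy : y⁻¹ * y' ∈ N := QuotientGroup.eq.mp (hyx.trans hyx'.symm)
    have hyyP : y⁻¹ * y' ∈ (P : Subgroup G) := mul_mem (inv_mem hy) hy'
    have hconjP := hP.isConj ⟨y, hy⟩ (fun h => hyN (mem_subgroupOf.mp h).2) ⟨_, hyyP⟩
      (mem_subgroupOf.mpr ⟨hyyP, hyy⟩)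
    have hconj : IsConj y y' := by
      have := (P : Subgroup G).subtype.map_isConj hconjP
      simpa using this
    have h1 := hK.isConj_mul_left P hFW hy hyN hk
    have h2 := hK.isConj_mul_left P hFW hy' hyN' hk'
    rw [hky] at h1
    rw [hky'] at h2
    exact h1.symm.trans (hconj.trans h2)

theorem IsCaminaPair.sylow {N : Subgroup G} [N.Normal] (hN : IsCaminaPair N) {n : ℕ}
    (hn : N.index = p ^ n) (hdvd : p ∣ Nat.card N) (P : Sylow p G) :
    IsCaminaPair (N.subgroupOf P) := by
  refine ⟨inferInstance, fun h => P.not_dvd_card_of_subgroupOf_eq_bot hn h hdvd, fun h => ?_,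
    fun x hx k hk => (hN.centralizer_le_sylow_and_isConj hn P hx).2 k hk⟩
  refine hN.ne_top ?_
  rw [← P.sup_eq_top_of_index_eq_pow hn, sup_eq_right.mpr (subgroupOf_eq_top.mp h)]

end Camina

/-! ### The equivalence -/

theorem theorem2p3 (p : ℕ) [Fact p.Prime] {G : Type*} [Group G] [Finite G]
    (N : Subgroup G) [N.Normal] (P : Sylow p G) :
    (IsCaminaPairType4 N ∧ IsPGroup p (G ⧸ N)) ↔
      (IsFrobeniusWielandtTriple (P : Subgroup G) ((P : Subgroup G) ⊓ N) ∧
        IsCaminaPair (((P : Subgroup G) ⊓ N).subgroupOf (P : Subgroup G)) ∧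
        ∃ K : Subgroup G, IsNormalPComplement p K ∧ K < N) := by
  rw [inf_subgroupOf_left]
  constructor
  · rintro ⟨⟨hN, q, hq, hqN, hdvd, hnp⟩, hp⟩
    obtain ⟨n, hn⟩ := isPGroup_quotient_iff_index.mp hp
    -- The index of `N` is a power of both primes and is not `1`.
    have hqp : q = p := by
      have := Fact.mk hq
      obtain ⟨m, hm⟩ := isPGroup_quotient_iff_index.mp hqN
      have hm0 : m ≠ 0 := by
        rintro rfl
        exact hN.ne_top (index_eq_one.mp hm)
      have : q ∣ p ^ n := hn ▸ hm ▸ dvd_pow_self q hm0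
      exact (Nat.prime_dvd_prime_iff_eq hq Fact.out).mp (hq.dvd_of_dvd_pow this)
    subst hqp
    have hP := hN.sylow hn hdvd P
    obtain ⟨K, hK, hKN⟩ := exists_isNormalPComplement_le P hn hP.le_commutator
    refine ⟨⟨?_, ?_, ?_, ?_, fun g hg => hN.inf_map_conj_le hn P hg⟩, hP, K, hK,
      lt_of_le_of_ne hKN ?_⟩
    · intro h
      exact hP.ne_bot (eq_bot_iff.mpr fun x _ => Subtype.ext (mem_bot.mp (h ▸ x.2)))
    · intro h
      exact hnp fun x => by
        obtain ⟨k, hk⟩ := P.isPGroup' ⟨x, h ▸ mem_top (x : G)⟩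
        exact ⟨k, Subtype.ext (by simpa using congrArg (fun z : P => (z : G)) hk)⟩
    · refine lt_of_le_of_ne inf_le_left fun h => hP.ne_top ?_
      exact subgroupOf_eq_top.mpr (inf_eq_left.mp h)
    · rw [inf_subgroupOf_left]
      infer_instance
    · rintro rfl
      exact hK.not_dvd_card hdvd
  · rintro ⟨hFW, hP, K, hK, hKN⟩
    obtain ⟨m, hm⟩ := hK.index_eq
    have hp : IsPGroup p (G ⧸ N) :=
      IsPGroup.of_card_dvd_pow (n := m) (hm ▸ index_dvd_of_le hKN.le)
    refine ⟨⟨IsCaminaPair.of_sylow P hFW (by rwa [inf_subgroupOf_left]) hK hKN, p, Fact.out, hp,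
      ?_, fun hNp => ?_⟩, hp⟩
    · have hle : (P : Subgroup G) ⊓ N ≤ N := inf_le_right
      refine dvd_trans ?_ (card_dvd_of_le hle)
      refine ((P.isPGroup'.to_le inf_le_left).card_eq_or_dvd).resolve_left fun h => hP.ne_bot ?_
      rw [card_eq_one] at h
      rw [← inf_subgroupOf_left, h, bot_subgroupOf]
    -- If `N` were a `p`-group, `K` would be trivial and `P` would be all of `G`.
    · have hKb : K = ⊥ := card_eq_one.mp
        ((hNp.to_le hKN.le).card_eq_or_dvd.resolve_right hK.not_dvd_card)
      refine hFW.ne_top ?_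
      rw [← P.sup_eq_top_of_index_eq_pow hm, hKb, sup_bot_eq]
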